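/- Let $u:\mathbb Z_{\ge0}\times\mathbb Z_{\ge0}\to\mathbb C$ be a hypergeometric term: each of the quotients $u(n+1,k)/u(n,k)$ and $u(n,k+1)/u(n,k)$ is given by a rational function of $n,k$; that is, there are pairs $(f,g)$ and $(\tilde f,\tilde g)$ of relatively prime polynomials in $\mathbb C[n,k]$ with $g,\tilde g\ne0$, such that $g(n,k)\,u(n+1,k)=f(n,k)\,u(n,k)$ and $\tilde g(n,k)\,u(n,k+1)=\tilde f(n,k)\,u(n,k)$ for all $n,k\ge0$. Assume that for all large enough $n$ the series $U(n)=\sum_{k=0}^\infty u(n,k)$ is nonterminating, i.e. has infinitely many nonzero terms. Call the sequence $U(n)$ uniformly dominated convergent if there are real constants $M_k$ with $|u(n,k)|\le M_k$ for all $n,k\ge 0$ and $\sum_{k=0}^\infty M_k<\infty$. Consider the following conditions. (a) For every $n\ge0$, the series $U(n)$ converges absolutely. (b) For every $k$ the limit $\lim_{n\to\infty}u(n,k)$ exists, and $\sum_{k=0}^\infty\lim_{n\to\infty}u(n,k)$ converges absolutely. (b$'$) For every $k$ the finite limit $\lim_{n\to\infty}|u(n,k)|$ exists, and $\sum_{k=0}^\infty\lim_{n\to\infty}|u(n,k)|$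 converges. (c) For every function $N:\mathbb Z_{\ge0}\to\mathbb Z_{\ge0}$ with $N(k)\sim C_0k^p$ as $k\to\infty$ for some real $p>1$ and $C_0\ne0$, the series $\sum_{k=0}^\infty u(N(k),k)$ converges absolutely. (d) For every function $N:\mathbb Z_{\ge0}\to\mathbb Z_{\ge0}$ with $N(k)\sim C_0k^p$ as $k\to\infty$ for some real $p\in(0,1)$ and $C_0\ne0$, the series $\sum_{k=0}^\infty u(N(k),k)$ converges absolutely. (e) For every function $N:\mathbb Z_{\ge0}\to\mathbb Z_{\ge0}$ of the form $N(k)=\lambda k+\omega(k)$ with real $\lambda>0$, where either $\omega(k)=O(1)$, or $\omega(k)\sim C_0k^p$ for some real $p\in(0,1)$ and $C_0\ne0$, the series $\sum_{k=0}^\infty u(N(k),k)$ converges absolutely. Then $U(n)$ is uniformly dominated convergent if and only if (a), (b$'$), (c), (d) and (e) hold. If moreover the limit $\lim_{n\to\infty}u(n,k)$ exists for every $k$, then $U(n)$ is uniformly dominated convergent if and only if (a), (b), (c), (d) and (e) hold. (In particular, (a)–(e) always imply uniformly dominated convergence.) -/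

import Mathlib

open Filter Topology Asymptotics

/-- The value `p(n,k)` of a bivariate complex polynomial at a pair of non-negative integers. -/
noncomputable def evalNK (p : MvPolynomial (Fin 2) ℂ) (n k : ℕ) : ℂ :=
  MvPolynomial.eval ![(n : ℂ), (k : ℂ)] p

/-- The quotient `v(n,k) / u(n,k)` is realized by a rational function of `n, k`. The rational
function is `f / g` in lowest terms, and the identity `v / u = f / g` is written with the
denominators cleared, so that it is meaningful also where `u` vanishes. -/
def QuotientIsRational (v u : ℕ → ℕ → ℂ) : Prop :=
  ∃ f g : MvPolynomial (Fin 2) ℂ, g ≠ 0 ∧ IsRelPrime f g ∧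
    ∀ n k : ℕ, evalNK g n k * v n k = evalNK f n k * u n k

/-- Bivariate hypergeometric terms: the quotients `u(n+1,k)/u(n,k)` and `u(n,k+1)/u(n,k)` are
rational functions of `n, k`. -/
def IsHypergeometricTerm (u : ℕ → ℕ → ℂ) : Prop :=
  QuotientIsRational (fun n k => u (n + 1) k) u ∧
    QuotientIsRational (fun n k => u n (k + 1)) u

/-- The series `∑ k, a k` is nonterminating: it has infinitely many nonzero terms. -/
def IsNonterminating (a : ℕ → ℂ) : Prop := {k : ℕ | a k ≠ 0}.Infinite

/-- Absolute convergence of the series `∑ k, a k`. -/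
def ConvergesAbsolutely (a : ℕ → ℂ) : Prop := Summable fun k => ‖a k‖

/-- The function series `∑ j, f j` on `E` satisfies the hypothesis of the Weierstrass M-test. -/
def UniformlyDominatedConvergent {E : Type*} (f : ℕ → E → ℂ) : Prop :=
  ∃ M : ℕ → ℝ, (∀ x j, ‖f j x‖ ≤ M j) ∧ Summable M

/-- `w(k) ~ C₀ k ^ p` as `k → ∞` for some real `C₀ ≠ 0`. -/
def HasPowerGrowth (w : ℕ → ℝ) (p : ℝ) : Prop :=
  ∃ C₀ : ℝ, C₀ ≠ 0 ∧ w ~[atTop] fun k : ℕ => C₀ * (k : ℝ) ^ p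

/-- `N(k) = lam * k + w(k)` with `lam > 0`, where `w(k) = O(1)`, or `w(k) ~ C₀ k ^ p` for some
`p ∈ (0,1)` and `C₀ ≠ 0`. -/
def IsLinearPath (N : ℕ → ℕ) : Prop :=
  ∃ (lam : ℝ) (w : ℕ → ℝ), 0 < lam ∧ (∀ k, (N k : ℝ) = lam * k + w k) ∧
    ((w =O[atTop] fun _ => (1 : ℝ)) ∨ ∃ p : ℝ, 0 < p ∧ p < 1 ∧ HasPowerGrowth w p)

/-- Condition (a): every series `∑ k, u(n,k)` converges absolutely. -/
def CondA (u : ℕ → ℕ → ℂ) : Prop := ∀ n, ConvergesAbsolutely (u n)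

/-- Condition (b): all the limits `lim_n u(n,k)` exist and their series converges absolutely. -/
def CondB (u : ℕ → ℕ → ℂ) : Prop :=
  ∃ L : ℕ → ℂ, (∀ k, Tendsto (fun n => u n k) atTop (𝓝 (L k))) ∧ ConvergesAbsolutely L

/-- Condition (b) for the moduli: all the limits `lim_n |u(n,k)|` exist (and are finite) and their
series converges. -/
def CondBAbs (u : ℕ → ℕ → ℂ) : Prop :=
  ∃ L : ℕ → ℝ, (∀ k, Tendsto (fun n => ‖u n k‖) atTop (𝓝 (L k))) ∧ Summable L

/-- Condition (c): absolute convergence along all `N(k) ~ C₀ k ^ p` with `p > 1`. -/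
def CondC (u : ℕ → ℕ → ℂ) : Prop :=
  ∀ (N : ℕ → ℕ) (p : ℝ), 1 < p → HasPowerGrowth (fun k => (N k : ℝ)) p →
    ConvergesAbsolutely fun k => u (N k) k

/-- Condition (d): absolute convergence along all `N(k) ~ C₀ k ^ p` with `0 < p < 1`. -/
def CondD (u : ℕ → ℕ → ℂ) : Prop :=
  ∀ (N : ℕ → ℕ) (p : ℝ), 0 < p → p < 1 → HasPowerGrowth (fun k => (N k : ℝ)) p →
    ConvergesAbsolutely fun k => u (N k) k

/-- Condition (e): absolute convergence along all linear paths. -/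
def CondE (u : ℕ → ℕ → ℂ) : Prop :=
  ∀ N : ℕ → ℕ, IsLinearPath N → ConvergesAbsolutely fun k => u (N k) k

/-! A dominating sequence bounds the series along every path, which gives (a), (c), (d), (e). For
(b'), the square of |u(n+1,k)/u(n,k)| is a quotient F/G of real polynomials, so F - G has eventually
constant sign in n and each bounded column has eventually monotone moduli.

Conversely, take M_k = sup_n |u(n,k)|. Either M_k is the limit of the column, controlled by (b'), or
it is first attained at some N(k). If N(k) ≠ 0, then F - G changes sign next to N(k) or G vanishes
there, so N(k) is within 1 of a zero of H(·,k) for one fixed polynomial H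
(`exists_polynomial_vanishing_near_max`).

Full Puiseux expansions are avoided. Balancing two monomials shows that such zeros are of order k^p
with finitely many possible p (`exists_exponents_of_zeros`). If M had infinite mass on these k,
pigeonhole and compactness (`exists_tendsto_on_nonsummable`) would give a subset, still of infinite
mass, on which x/k^p converges to a nonzero constant. There (a) contradicts p ≤ 0, and (c) or (d)
contradicts positive p ≠ 1. For p = 1 the same argument, applied to the deviation from the line,
contradicts (e). -/

/-! ### Squared moduli as real polynomials. -/

theorem exists_real_add_I_mul_real (g : MvPolynomial (Fin 2) ℂ) :
    ∃ a b : MvPolynomial (Fin 2) ℝ,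
      g = MvPolynomial.map (algebraMap ℝ ℂ) a +
        MvPolynomial.C Complex.I * MvPolynomial.map (algebraMap ℝ ℂ) b := by
  induction g using MvPolynomial.induction_on with
  | C z =>
    refine ⟨MvPolynomial.C z.re, MvPolynomial.C z.im, ?_⟩
    rw [MvPolynomial.map_C, MvPolynomial.map_C, ← map_mul, ← map_add]
    congr 1
    simp [mul_comm Complex.I, Complex.re_add_im]
  | add p q hp hq =>
    obtain ⟨a, b, rfl⟩ := hp
    obtain ⟨c, d, rfl⟩ := hq
    exact ⟨a + c, b + d, by simp only [map_add]; ring⟩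
  | mul_X p i hp =>
    obtain ⟨a, b, rfl⟩ := hp
    exact ⟨a * MvPolynomial.X i, b * MvPolynomial.X i, by
      simp only [map_mul, MvPolynomial.map_X]; ring⟩

theorem evalNK_map (a : MvPolynomial (Fin 2) ℝ) (n k : ℕ) :
    evalNK (MvPolynomial.map (algebraMap ℝ ℂ) a) n k =
      ((MvPolynomial.eval ![(n : ℝ), (k : ℝ)] a : ℝ) : ℂ) := by
  have h : (![(n : ℂ), (k : ℂ)] : Fin 2 → ℂ) = algebraMap ℝ ℂ ∘ ![(n : ℝ), (k : ℝ)] := by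
    ext i; fin_cases i <;> simp
  rw [evalNK, MvPolynomial.eval_map, h, ← MvPolynomial.eval₂_comp]
  rfl

/-- The squared modulus of a complex polynomial is a real polynomial. -/
theorem exists_normSq_polynomial (g : MvPolynomial (Fin 2) ℂ) :
    ∃ G : MvPolynomial (Fin 2) ℝ,
      (∀ n k : ℕ, MvPolynomial.eval ![(n : ℝ), (k : ℝ)] G = ‖evalNK g n k‖ ^ 2) ∧
      (g ≠ 0 → G ≠ 0) := by
  obtain ⟨a, b, rfl⟩ := exists_real_add_I_mul_real g
  refine ⟨a ^ 2 + b ^ 2, fun n k => ?_, fun hg hG => hg ?_⟩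
  · have h : evalNK (MvPolynomial.map (algebraMap ℝ ℂ) a +
        MvPolynomial.C Complex.I * MvPolynomial.map (algebraMap ℝ ℂ) b) n k =
        evalNK (MvPolynomial.map (algebraMap ℝ ℂ) a) n k +
        Complex.I * evalNK (MvPolynomial.map (algebraMap ℝ ℂ) b) n k := by
      simp [evalNK]
    rw [h, evalNK_map, evalNK_map, ← Complex.normSq_eq_norm_sq, Complex.normSq_apply]
    simp
    ring
  · have h : ∀ v, MvPolynomial.eval v a = 0 ∧ MvPolynomial.eval v b = 0 := fun v => by
      have h1 := congrArg (MvPolynomial.eval v) hG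
      simp only [map_add, map_pow, map_zero] at h1
      constructor <;> nlinarith [sq_nonneg (MvPolynomial.eval v a),
        sq_nonneg (MvPolynomial.eval v b)]
    have ha : a = 0 := MvPolynomial.funext fun v => by simp [(h v).1]
    have hb : b = 0 := MvPolynomial.funext fun v => by simp [(h v).2]
    simp [ha, hb]

/-! ### Growth exponents of zeros. -/

/-- In a vanishing finite sum with a nonzero term, two distinct terms are comparable. -/
theorem exists_comparable_terms {ι : Type*} (s : Finset ι) (hs : s.Nonempty)
    (w : ι → ℝ) (hw : ∀ i ∈ s, w i ≠ 0) (h0 : ∑ i ∈ s, w i = 0) :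
    ∃ i ∈ s, ∃ j ∈ s, j ≠ i ∧ |w j| ≤ |w i| ∧ |w i| ≤ s.card * |w j| := by
  classical
  obtain ⟨i, hi, hmax⟩ := s.exists_max_image (fun i => |w i|) hs
  -- If all other terms were smaller than 1/card of the largest, they could not cancel it.
  by_contra! hcon
  have h1 : ∀ j ∈ s.erase i, s.card * |w j| < |w i| := fun j hj =>
    hcon i hi j (Finset.mem_of_mem_erase hj) (Finset.ne_of_mem_erase hj)
      (hmax j (Finset.mem_of_mem_erase hj))
  have hwi : 0 < |w i| := abs_pos.2 (hw i hi)
  have hcard : 0 < (s.card : ℝ) := by exact_mod_cast hs.card_pos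
  have h2 : w i = -∑ j ∈ s.erase i, w j := by
    rw [← Finset.add_sum_erase s w hi] at h0; linarith
  have h3 : |w i| ≤ ∑ j ∈ s.erase i, |w j| := by
    rw [h2, abs_neg]; exact Finset.abs_sum_le_sum_abs _ _
  have h4 : s.card * |w i| ≤ (s.erase i).card * |w i| := by
    calc s.card * |w i| ≤ s.card * ∑ j ∈ s.erase i, |w j| := by gcongr
      _ = ∑ j ∈ s.erase i, s.card * |w j| := Finset.mul_sum _ _ _
      _ ≤ ∑ j ∈ s.erase i, |w i| := Finset.sum_le_sum fun j hj => (h1 j hj).le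
      _ = (s.erase i).card * |w i| := by simp
  have h5 : ((s.erase i).card : ℝ) < s.card := by
    exact_mod_cast Finset.card_erase_lt_of_mem hi
  nlinarith

/-- A weak form of the Newton polygon: the zeros `x` of `H(·, y)` have, for large `y`, the order of
magnitude of `y ^ p` for one of finitely many exponents `p`. -/
theorem exists_exponents_of_zeros (H : MvPolynomial (Fin 2) ℝ) (hH : H ≠ 0) :
    ∃ (E : Finset ℝ) (D Y : ℝ), ∀ x y : ℝ, x ≠ 0 → Y ≤ y →
      MvPolynomial.eval ![x, y] H = 0 → ∃ p ∈ E, |Real.log |x| - p * Real.log y| ≤ D := by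
  classical
  have hs : H.support.Nonempty := MvPolynomial.support_nonempty.2 hH
  let A : ℝ := ∑ s ∈ H.support, |Real.log (|H.coeff s|)|
  have hA : ∀ s ∈ H.support, |Real.log (|H.coeff s|)| ≤ A := fun s hs =>
    Finset.single_le_sum (f := fun s => |Real.log (|H.coeff s|)|) (fun _ _ => abs_nonneg _) hs
  have hcard : 1 ≤ (H.support.card : ℝ) := by exact_mod_cast hs.card_pos
  let D : ℝ := Real.log H.support.card + 2 * A
  have hA0 : 0 ≤ A := Finset.sum_nonneg fun _ _ => abs_nonneg _
  -- This p makes two monomials have the same order when x ~ y ^ p. Pairs with equal x-degree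
  -- contribute a harmless 0; they never balance, because y ≥ exp (D + 1) gives log y > D.
  refine ⟨(H.support ×ˢ H.support).image fun q =>
      ((q.2 1 : ℝ) - q.1 1) / ((q.1 0 : ℝ) - q.2 0), D, Real.exp (D + 1), ?_⟩
  intro x y hx hy h0
  have hy0 : 0 < y := (Real.exp_pos _).trans_le hy
  have hly : D + 1 ≤ Real.log y := (Real.le_log_iff_exp_le hy0).2 hy
  rw [MvPolynomial.eval_eq'] at h0
  simp only [Fin.prod_univ_two, Matrix.cons_val_zero, Matrix.cons_val_one] at h0
  have hne : ∀ s ∈ H.support, H.coeff s * (x ^ s 0 * y ^ s 1) ≠ 0 := fun s hs =>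
    mul_ne_zero (MvPolynomial.mem_support_iff.1 hs)
      (mul_ne_zero (pow_ne_zero _ hx) (pow_ne_zero _ hy0.ne'))
  have hlog : ∀ s ∈ H.support, Real.log |H.coeff s * (x ^ s 0 * y ^ s 1)| =
      Real.log |H.coeff s| + (s 0 * Real.log |x| + s 1 * Real.log y) := fun s hs => by
    rw [abs_mul, abs_mul, abs_pow, abs_pow, abs_of_pos hy0, Real.log_mul, Real.log_mul,
      Real.log_pow, Real.log_pow]
    all_goals first | positivity | exact abs_ne_zero.2 (MvPolynomial.mem_support_iff.1 hs)
  obtain ⟨s, hs', t, ht, hts, h1, h2⟩ := exists_comparable_terms H.support hs _ hne h0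
  have hps := abs_pos.2 (hne s hs')
  have hpt := abs_pos.2 (hne t ht)
  have h3 := Real.log_le_log hpt h1
  have h4 := Real.log_le_log hps h2
  rw [Real.log_mul (by positivity) hpt.ne', hlog s hs', hlog t ht] at h4
  rw [hlog s hs', hlog t ht] at h3
  have hAs := abs_le.1 (hA s hs')
  have hAt := abs_le.1 (hA t ht)
  have hl : 0 ≤ Real.log H.support.card := Real.log_nonneg hcard
  have h5 : |((s 0 : ℝ) - t 0) * Real.log |x| - ((t 1 : ℝ) - s 1) * Real.log y| ≤ D := by
    rw [abs_le]; constructor <;> simp only [D] <;> linarith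
  by_cases h01 : s 0 = t 0
  · exfalso
    have h11 : s 1 ≠ t 1 := fun h11 => hts (by ext i; fin_cases i <;> simp [h01, h11])
    have h6 : (1 : ℝ) ≤ |((t 1 : ℝ) - s 1)| := by
      have : (1 : ℤ) ≤ |((t 1 : ℤ) - s 1)| := Int.one_le_abs (by omega)
      exact_mod_cast this
    rw [h01, sub_self, zero_mul, zero_sub, abs_neg, abs_mul] at h5
    have h7 : Real.log y ≤ |Real.log y| := le_abs_self _
    nlinarith [abs_nonneg (Real.log y)]
  · refine ⟨_, Finset.mem_image_of_mem _ (Finset.mk_mem_product hs' ht), ?_⟩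
    have h6 : (1 : ℝ) ≤ |((s 0 : ℝ) - t 0)| := by
      have : (1 : ℤ) ≤ |((s 0 : ℤ) - t 0)| := Int.one_le_abs (by omega)
      exact_mod_cast this
    have h7 : (s 0 : ℝ) - t 0 ≠ 0 := fun h => by rw [h] at h6; norm_num at h6
    have h8 : ((s 0 : ℝ) - t 0) * Real.log |x| - ((t 1 : ℝ) - s 1) * Real.log y =
        ((s 0 : ℝ) - t 0) *
          (Real.log |x| - ((t 1 : ℝ) - s 1) / ((s 0 : ℝ) - t 0) * Real.log y) := by
      field_simp
    rw [h8, abs_mul] at h5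
    exact (le_mul_of_one_le_left (abs_nonneg _) h6).trans h5

/-! ### Sets of indices of infinite mass. -/

theorem summable_indicator_of_le {M a : ℕ → ℝ} (hM : ∀ k, 0 ≤ M k) (ha : Summable a)
    (ha0 : ∀ k, 0 ≤ a k) {S : Set ℕ} (h : ∀ k ∈ S, M k ≤ a k) : Summable (S.indicator M) :=
  Summable.of_nonneg_of_le (fun _ => Set.indicator_nonneg (fun k _ => hM k) _)
    (fun k => Set.indicator_le' h (fun k _ => ha0 k) k) ha

theorem summable_indicator_subset {M : ℕ → ℝ} {S T : Set ℕ}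
    (hT : Summable (T.indicator M)) (h : S ⊆ T) : Summable (S.indicator M) := by
  have := hT.indicator S
  rwa [Set.indicator_indicator, Set.inter_eq_left.2 h] at this

theorem summable_indicator_union {M : ℕ → ℝ} {S T : Set ℕ}
    (hS : Summable (S.indicator M)) (hT : Summable (T.indicator M)) :
    Summable ((S ∪ T).indicator M) := by
  have h : (S ∪ T) = S ∪ (T \ S) := by simp
  rw [h, Set.indicator_union_of_disjoint Set.disjoint_sdiff_right]
  exact hS.add (summable_indicator_subset hT Set.sdiff_subset)

theorem summable_indicator_biUnion {M : ℕ → ℝ} {ι : Type*} (E : Finset ι) (S : ι → Set ℕ)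
    (h : ∀ i ∈ E, Summable ((S i).indicator M)) : Summable ((⋃ i ∈ E, S i).indicator M) := by
  classical
  induction E using Finset.induction_on with
  | empty => simp
  | insert a E _ ih =>
    rw [Finset.set_biUnion_insert]
    exact summable_indicator_union (h a (Finset.mem_insert_self _ _))
      (ih fun i hi => h i (Finset.mem_insert_of_mem hi))

theorem summable_indicator_finite {M : ℕ → ℝ} {S : Set ℕ} (hS : S.Finite) :
    Summable (S.indicator M) :=
  summable_of_hasFiniteSupport (hS.subset Set.support_indicator_subset)

theorem exists_one_le_sum_Ico {a : ℕ → ℝ} (ha : ∀ k, 0 ≤ a k) (h : ¬ Summable a) (m : ℕ) :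
    ∃ m', m < m' ∧ 1 ≤ ∑ k ∈ Finset.Ico m m', a k := by
  by_contra! hcon
  refine h (summable_of_sum_range_le (c := ∑ k ∈ Finset.range m, a k + 1) ha fun n => ?_)
  have h1 := hcon (max n m + 1) (by omega)
  calc ∑ k ∈ Finset.range n, a k ≤ ∑ k ∈ Finset.range (max n m + 1), a k :=
        Finset.sum_le_sum_of_subset_of_nonneg
          (Finset.range_subset_range.2 (by omega)) fun k _ _ => ha k
    _ = _ := (Finset.sum_range_add_sum_Ico a (show m ≤ max n m + 1 by omega)).symm
    _ ≤ _ := by linarith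

/-- A decreasing sequence of sets of infinite mass has a pseudo-intersection of infinite mass. -/
theorem exists_pseudo_intersection {M : ℕ → ℝ} (hM : ∀ k, 0 ≤ M k) {A : ℕ → Set ℕ}
    (hA : Antitone A) (hbig : ∀ j, ¬ Summable ((A j).indicator M)) :
    ∃ S ⊆ A 0, ¬ Summable (S.indicator M) ∧ ∀ j, ∀ᶠ k in atTop, k ∈ S → k ∈ A j := by
  have hnn : ∀ j k, 0 ≤ (A j).indicator M k :=
    fun j k => Set.indicator_nonneg (fun k _ => hM k) _
  choose F hF1 hF2 using fun j m => exists_one_le_sum_Ico (hnn j) (hbig j) m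
  let b : ℕ → ℕ := fun j => Nat.rec 0 (fun j m => F j m) j
  have hb : ∀ j, b (j + 1) = F j (b j) := fun j => rfl
  have hbm : StrictMono b := strictMono_nat_of_lt_succ fun j => by rw [hb]; exact hF1 _ _
  -- On [b j, b (j + 1)) this coincides with `A j`, since the sets decrease; so every block keeps
  -- mass at least 1.
  let S : Set ℕ := {k | ∀ j, b j ≤ k → k ∈ A j}
  have hle : ∀ j, 1 ≤ ∑ k ∈ Finset.Ico (b j) (b (j + 1)), S.indicator M k := fun j => by
    rw [hb]
    refine (hF2 j (b j)).trans (Finset.sum_le_sum fun k hk => ?_)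
    rw [Finset.mem_Ico, ← hb] at hk
    by_cases hkA : k ∈ A j
    · have hkS : k ∈ S := fun i hi => by
        have : i < j + 1 := hbm.lt_iff_lt.1 (hi.trans_lt hk.2)
        exact hA (Nat.lt_succ_iff.1 this) hkA
      simp [hkA, hkS]
    · rw [Set.indicator_of_notMem hkA]
      exact Set.indicator_nonneg (fun k _ => hM k) _
  refine ⟨S, fun k hk => hk 0 (Nat.zero_le _), fun hS => ?_, fun j => ?_⟩
  · have h1 : ∀ j : ℕ, (j : ℝ) ≤ ∑ k ∈ Finset.range (b j), S.indicator M k := fun j => by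
      induction j with
      | zero => simp [b]
      | succ j ih =>
        rw [← Finset.sum_range_add_sum_Ico _ (hbm.monotone (Nat.le_succ j))]
        push_cast
        linarith [hle j]
    obtain ⟨j, hj⟩ := exists_nat_gt (∑' k, S.indicator M k)
    have h2 := hS.sum_le_tsum (Finset.range (b j))
      fun k _ => Set.indicator_nonneg (fun k _ => hM k) k
    linarith [h1 j]
  · filter_upwards [eventually_ge_atTop (b j)] with k hk hkS using hkS j hk

/-- A function with values in a compact set converges along a set of infinite mass. -/
theorem exists_tendsto_on_nonsummable {M : ℕ → ℝ} (hM : ∀ k, 0 ≤ M k) {S : Set ℕ}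
    (hS : ¬ Summable (S.indicator M)) {t : ℕ → ℝ} {K : Set ℝ} (hK : IsCompact K)
    (ht : ∀ k ∈ S, t k ∈ K) :
    ∃ S' ⊆ S, ¬ Summable (S'.indicator M) ∧ ∃ c ∈ K, Tendsto t (atTop ⊓ 𝓟 S') (𝓝 c) := by
  -- Otherwise finitely many balls of finite mass would cover K.
  have key : ∃ c ∈ K, ∀ ε > 0, ¬ Summable ((S ∩ t ⁻¹' Metric.ball c ε).indicator M) := by
    by_contra! hcon
    choose! ε hε hsum using hcon
    obtain ⟨T, hT, hcov⟩ := hK.elim_nhds_subcover (fun c => Metric.ball c (ε c))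
      fun c hc => Metric.ball_mem_nhds c (hε c hc)
    refine hS (summable_indicator_subset
      (summable_indicator_biUnion T _ fun c hc => hsum c (hT c hc)) fun k hk => ?_)
    obtain ⟨c, hc, hkc⟩ := Set.mem_iUnion₂.1 (hcov (ht k hk))
    exact Set.mem_iUnion₂.2 ⟨c, hc, hk, hkc⟩
  obtain ⟨c, hc, hbig⟩ := key
  obtain ⟨S', hS', hS'big, hev⟩ := exists_pseudo_intersection hM
    (A := fun j => S ∩ t ⁻¹' Metric.ball c (1 / ((j : ℝ) + 1)))
    (fun i j hij => Set.inter_subset_inter_right _ (Set.preimage_mono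
      (Metric.ball_subset_ball (one_div_le_one_div_of_le (by positivity) (by
        have : (i : ℝ) ≤ j := by exact_mod_cast hij
        linarith)))))
    fun j => hbig _ (by positivity)
  refine ⟨S', fun k hk => (hS' hk).1, hS'big, c, hc, Metric.tendsto_nhds.2 fun ε hε => ?_⟩
  obtain ⟨j, hj⟩ := exists_nat_one_div_lt hε
  rw [eventually_inf_principal]
  filter_upwards [hev j] with k hk hkS using (Metric.mem_ball.1 (hk hkS).2).trans hj

theorem exists_nonsummable_of_subset_biUnion {M : ℕ → ℝ} {S : Set ℕ}
    (hS : ¬ Summable (S.indicator M)) {ι : Type*} {E : Finset ι} {T : ι → Set ℕ}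
    (h : S ⊆ ⋃ i ∈ E, T i) : ∃ i ∈ E, ¬ Summable ((T i).indicator M) := by
  by_contra! hcon
  exact hS (summable_indicator_subset (summable_indicator_biUnion E T hcon) h)

theorem neBot_atTop_inf_principal_of_nonsummable {M : ℕ → ℝ} {S : Set ℕ}
    (hS : ¬ Summable (S.indicator M)) : NeBot (atTop ⊓ 𝓟 S) := by
  refine neBot_iff.2 fun h => hS (summable_indicator_finite ?_)
  rw [← Nat.cofinite_eq_atTop, inf_principal_eq_bot, mem_cofinite, compl_compl] at h
  exact h

/-! ### Power growth. -/

/-- The compact set of reals whose modulus is between `exp (-D)` and `exp D`. -/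
def logAnnulus (D : ℝ) : Set ℝ := {t | Real.exp (-D) ≤ |t| ∧ |t| ≤ Real.exp D}

theorem isCompact_logAnnulus (D : ℝ) : IsCompact (logAnnulus D) := by
  refine (isCompact_Icc (a := -Real.exp D) (b := Real.exp D)).of_isClosed_subset ?_
    fun t ht => abs_le.1 ht.2
  exact (isClosed_le continuous_const continuous_abs).inter
    (isClosed_le continuous_abs continuous_const)

/-- The lower bound supplies the nonzero constant that `HasPowerGrowth` requires. -/
theorem ne_zero_of_mem_logAnnulus {D c : ℝ} (hc : c ∈ logAnnulus D) : c ≠ 0 :=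
  abs_pos.1 ((Real.exp_pos _).trans_le hc.1)

theorem div_rpow_mem_logAnnulus {x y p D : ℝ} (hx : x ≠ 0) (hy : 0 < y)
    (h : |Real.log |x| - p * Real.log y| ≤ D) : x / y ^ p ∈ logAnnulus D := by
  have h1 : |x / y ^ p| = Real.exp (Real.log |x| - p * Real.log y) := by
    rw [abs_div, Real.exp_sub, Real.exp_log (abs_pos.2 hx), abs_of_pos (Real.rpow_pos_of_pos hy p),
      Real.rpow_def_of_pos hy, mul_comm p]
  obtain ⟨h2, h3⟩ := abs_le.1 h
  exact ⟨by rw [h1]; gcongr, by rw [h1]; gcongr⟩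

theorem tendsto_natCast_rpow_atTop {p : ℝ} (hp : 0 < p) :
    Tendsto (fun k : ℕ => (k : ℝ) ^ p) atTop atTop :=
  (tendsto_rpow_atTop hp).comp tendsto_natCast_atTop_atTop

theorem tendsto_div_rpow_of_bounded {p B : ℝ} (hp : 0 < p) {e : ℕ → ℝ} {l : Filter ℕ}
    (hl : l ≤ atTop) (he : ∀ᶠ k in l, |e k| ≤ B) :
    Tendsto (fun k => e k / (k : ℝ) ^ p) l (𝓝 0) := by
  have h1 : Tendsto (fun k : ℕ => B / (k : ℝ) ^ p) l (𝓝 0) :=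
    ((tendsto_natCast_rpow_atTop hp).const_div_atTop B).mono_left hl
  refine squeeze_zero_norm' ?_ h1
  filter_upwards [he] with k hk
  have h0 : 0 ≤ (k : ℝ) ^ p := Real.rpow_nonneg (Nat.cast_nonneg _) _
  rw [Real.norm_eq_abs, abs_div, abs_of_nonneg h0]
  gcongr

theorem hasPowerGrowth_of_tendsto {w : ℕ → ℝ} {p C : ℝ} (hC : C ≠ 0)
    (h : Tendsto (fun k : ℕ => w k / (k : ℝ) ^ p) atTop (𝓝 C)) : HasPowerGrowth w p := by
  refine ⟨C, hC, ?_⟩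
  have hev : ∀ᶠ k : ℕ in atTop, (k : ℝ) ^ p ≠ 0 := by
    filter_upwards [eventually_gt_atTop 0] with k hk
    have : (0 : ℝ) < k := by exact_mod_cast hk
    positivity
  rw [isEquivalent_iff_tendsto_one (by filter_upwards [hev] with k hk using mul_ne_zero hC hk)]
  have h2 := h.div_const C
  rw [div_self hC] at h2
  refine h2.congr fun k => ?_
  simp only [Pi.div_apply]
  rw [div_div, mul_comm C]

/-! ### Summability along partially defined paths. -/

section Paths

variable {u : ℕ → ℕ → ℂ} {M : ℕ → ℝ} {S : Set ℕ} {N : ℕ → ℕ}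

/-- The conditions speak of paths with asymptotics on all of ℕ, while `N` is controlled on `S` only;
below, `N'` replaces it off `S` by a rounded model path. -/
theorem summable_indicator_of_path (hM : ∀ k, 0 ≤ M k) (hN : ∀ k ∈ S, M k ≤ ‖u (N k) k‖)
    {N' : ℕ → ℕ} (hNN : ∀ k ∈ S, N' k = N k) (h : ConvergesAbsolutely fun k => u (N' k) k) :
    Summable (S.indicator M) :=
  summable_indicator_of_le hM h (fun _ => norm_nonneg _) fun k hk => by
    simpa only [hNN k hk] using hN k hk

/-- `N` takes finitely many values on `S`, and each value is a single row. -/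
theorem summable_indicator_of_bounded (hM : ∀ k, 0 ≤ M k) (ha : CondA u)
    (hN : ∀ k ∈ S, M k ≤ ‖u (N k) k‖) {B : ℝ} (hB : ∀ k ∈ S, (N k : ℝ) ≤ B) :
    Summable (S.indicator M) := by
  by_contra hS
  obtain ⟨n, -, hn⟩ := exists_nonsummable_of_subset_biUnion hS
    (E := Finset.range (⌊B⌋₊ + 1)) (T := fun n => {k | k ∈ S ∧ N k = n}) fun k hk =>
      Set.mem_iUnion₂.2 ⟨N k, Finset.mem_range.2 (Nat.lt_succ_of_le (Nat.le_floor (hB k hk))),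
        hk, rfl⟩
  exact hn (summable_indicator_of_path hM (fun k hk => hN k hk.1) (N' := fun _ => n)
    (fun k hk => hk.2.symm) (ha n))

theorem summable_indicator_of_tendsto_div_rpow (hM : ∀ k, 0 ≤ M k) (hc : CondC u) (hd : CondD u)
    (hN : ∀ k ∈ S, M k ≤ ‖u (N k) k‖) {p C : ℝ} (hp : 0 < p) (hp1 : p ≠ 1) (hC : 0 < C)
    (h : Tendsto (fun k => (N k : ℝ) / (k : ℝ) ^ p) (atTop ⊓ 𝓟 S) (𝓝 C)) :
    Summable (S.indicator M) := by
  classical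
  have h1 : Tendsto (fun k : ℕ => ((⌊C * (k : ℝ) ^ p⌋₊ : ℕ) : ℝ) / (k : ℝ) ^ p) atTop (𝓝 C) :=
    (tendsto_nat_floor_mul_div_atTop hC.le).comp (tendsto_natCast_rpow_atTop hp)
  let N' : ℕ → ℕ := fun k => if k ∈ S then N k else ⌊C * (k : ℝ) ^ p⌋₊
  have h2 : Tendsto (fun k => (N' k : ℝ) / (k : ℝ) ^ p) atTop (𝓝 C) := by
    refine (Tendsto.if (p := (· ∈ S)) h (h1.mono_left inf_le_left)).congr fun k => ?_
    by_cases hk : k ∈ S <;> simp [N', hk]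
  have h3 := hasPowerGrowth_of_tendsto hC.ne' h2
  refine summable_indicator_of_path hM hN (N' := N') (fun k hk => if_pos hk) ?_
  rcases lt_or_gt_of_ne hp1 with hlt | hgt
  · exact hd N' p hp hlt h3
  · exact hc N' p hgt h3

theorem summable_indicator_of_linear_bounded (hM : ∀ k, 0 ≤ M k) (he : CondE u)
    (hN : ∀ k ∈ S, M k ≤ ‖u (N k) k‖) {lam B : ℝ} (hlam : 0 < lam)
    (h : ∀ k ∈ S, |(N k : ℝ) - lam * k| ≤ B) : Summable (S.indicator M) := by
  classical
  let N' : ℕ → ℕ := fun k => if k ∈ S then N k else ⌊lam * k⌋₊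
  refine summable_indicator_of_path hM hN (N' := N') (fun k hk => if_pos hk) (he N' ?_)
  refine ⟨lam, fun k => N' k - lam * k, hlam, fun k => by ring, Or.inl ?_⟩
  refine IsBigO.of_bound (max B 1) (Eventually.of_forall fun k => ?_)
  rw [norm_one, mul_one, Real.norm_eq_abs]
  by_cases hk : k ∈ S
  · simp only [N', if_pos hk]
    exact (h k hk).trans (le_max_left _ _)
  · simp only [N', if_neg hk]
    refine le_trans ?_ (le_max_right _ _)
    have h0 : 0 ≤ lam * k := by positivity
    rw [abs_le]
    constructor <;> linarith [Nat.floor_le h0, Nat.lt_floor_add_one (lam * k)]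

theorem summable_indicator_of_linear_rpow (hM : ∀ k, 0 ≤ M k) (he : CondE u)
    (hN : ∀ k ∈ S, M k ≤ ‖u (N k) k‖) {lam q C : ℝ} (hlam : 0 < lam) (hq : 0 < q) (hq1 : q < 1)
    (hC : C ≠ 0)
    (h : Tendsto (fun k => ((N k : ℝ) - lam * k) / (k : ℝ) ^ q) (atTop ⊓ 𝓟 S) (𝓝 C)) :
    Summable (S.indicator M) := by
  classical
  let N' : ℕ → ℕ := fun k => if k ∈ S then N k else ⌊lam * k + C * (k : ℝ) ^ q⌋₊
  refine summable_indicator_of_path hM hN (N' := N') (fun k hk => if_pos hk) (he N' ?_)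
  refine ⟨lam, fun k => N' k - lam * k, hlam, fun k => by ring,
    Or.inr ⟨q, hq, hq1, hasPowerGrowth_of_tendsto hC ?_⟩⟩
  -- For C < 0 the natural floor may truncate to 0, but only for finitely many k because q < 1.
  have hpos : ∀ᶠ k : ℕ in atTop, 0 ≤ lam * k + C * (k : ℝ) ^ q := by
    have h1 := (tendsto_natCast_rpow_atTop (sub_pos.2 hq1)).eventually_ge_atTop (-C / lam)
    filter_upwards [h1, eventually_gt_atTop 0] with k hk hk0
    have hk0' : (0 : ℝ) < k := by exact_mod_cast hk0
    rw [div_le_iff₀ hlam] at hk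
    have h2 : (k : ℝ) = (k : ℝ) ^ (1 - q) * (k : ℝ) ^ q := by
      rw [← Real.rpow_add hk0']; simp
    have h3 : (0 : ℝ) < (k : ℝ) ^ q := by positivity
    have h4 : lam * k = ((k : ℝ) ^ (1 - q) * lam) * (k : ℝ) ^ q := by
      nth_rewrite 1 [h2]; ring
    rw [h4]
    nlinarith
  have hfl : Tendsto (fun k : ℕ => ((⌊lam * k + C * (k : ℝ) ^ q⌋₊ : ℝ) - lam * k) / (k : ℝ) ^ q)
      atTop (𝓝 C) := by
    have h1 := tendsto_div_rpow_of_bounded (B := 1) hq le_rfl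
      (e := fun k : ℕ => (⌊lam * k + C * (k : ℝ) ^ q⌋₊ : ℝ) - (lam * k + C * (k : ℝ) ^ q)) (by
        filter_upwards [hpos] with k hk
        rw [abs_le]
        constructor <;>
          linarith [Nat.floor_le hk, Nat.lt_floor_add_one (lam * k + C * (k : ℝ) ^ q)])
    have h2 := h1.add_const C
    rw [zero_add] at h2
    refine h2.congr' ?_
    filter_upwards [eventually_gt_atTop 0] with k hk0
    have hk0' : (0 : ℝ) < k := by exact_mod_cast hk0
    field_simp
    ring
  refine (Tendsto.if (p := (· ∈ S)) h (hfl.mono_left inf_le_left)).congr fun k => ?_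
  by_cases hk : k ∈ S <;> simp [N', hk]

/-- The shear is invertible, so `Q` is nonzero and the exponent bound applies to deviations from the
line. -/
theorem exists_linear_substitution (H : MvPolynomial (Fin 2) ℝ) (hH : H ≠ 0) (lam : ℝ) :
    ∃ Q : MvPolynomial (Fin 2) ℝ, Q ≠ 0 ∧ ∀ z y : ℝ,
      MvPolynomial.eval ![z, y] Q = MvPolynomial.eval ![lam * y + z, y] H := by
  let Q : MvPolynomial (Fin 2) ℝ := MvPolynomial.bind₁ ![MvPolynomial.C lam * MvPolynomial.X 1 + MvPolynomial.X 0,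
    MvPolynomial.X 1] H
  have hev : ∀ z y : ℝ,
      MvPolynomial.eval ![z, y] Q = MvPolynomial.eval ![lam * y + z, y] H := fun z y => by
    simp only [Q, MvPolynomial.eval, MvPolynomial.eval₂Hom_bind₁]
    congr 2
    ext i
    fin_cases i <;> simp
  refine ⟨Q, fun hQ => hH (MvPolynomial.funext fun v => ?_), hev⟩
  have h := hev (v 0 - lam * v 1) (v 1)
  rw [hQ, add_sub_cancel] at h
  have hv : ![v 0, v 1] = v := by ext i; fin_cases i <;> rfl
  rw [hv] at h
  rw [← h, map_zero, map_zero]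

/-- Terms taken near the zeros of a polynomial whose zeros lie close to a line are summable. -/
theorem summable_indicator_of_near_linear (hM : ∀ k, 0 ≤ M k) (he : CondE u)
    (hN : ∀ k ∈ S, M k ≤ ‖u (N k) k‖) {x : ℕ → ℝ} {H : MvPolynomial (Fin 2) ℝ} (hH : H ≠ 0)
    (hx : ∀ k ∈ S, |(N k : ℝ) - x k| ≤ 1)
    (h0 : ∀ k ∈ S, MvPolynomial.eval ![x k, (k : ℝ)] H = 0) {lam : ℝ} (hlam : 0 < lam)
    (h : Tendsto (fun k => x k / (k : ℝ)) (atTop ⊓ 𝓟 S) (𝓝 lam)) :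
    Summable (S.indicator M) := by
  obtain ⟨Q, hQ, hQev⟩ := exists_linear_substitution H hH lam
  obtain ⟨E, D, Y, hE⟩ := exists_exponents_of_zeros Q hQ
  let z : ℕ → ℝ := fun k => x k - lam * k
  have hz0 : ∀ k ∈ S, MvPolynomial.eval ![z k, (k : ℝ)] Q = 0 := fun k hk => by
    rw [hQev, add_sub_cancel]; exact h0 k hk
  have hNz : ∀ k ∈ S, |((N k : ℝ) - lam * k) - z k| ≤ 1 := fun k hk => by
    have : (N k : ℝ) - lam * k - z k = N k - x k := by simp only [z]; ring
    rw [this]; exact hx k hk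
  by_contra hS
  let K : ℕ := max 1 ⌈Y⌉₊
  -- `none` collects the k that the exponent bound leaves out: small k and zeros exactly on the
  -- line.
  let T : Option ℝ → Set ℕ := fun o => o.elim {k | k < K ∨ k ∈ S ∧ z k = 0}
    fun q => {k | k ∈ S ∧ K ≤ k ∧ z k ≠ 0 ∧ |Real.log |z k| - q * Real.log k| ≤ D}
  obtain ⟨o, -, ho⟩ := exists_nonsummable_of_subset_biUnion hS (E := Finset.insertNone E) (T := T)
    (by
      intro k hk
      by_cases hkK : k < K
      · exact Set.mem_iUnion₂.2 ⟨none, by simp, Or.inl hkK⟩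
      · by_cases hzk : z k = 0
        · exact Set.mem_iUnion₂.2 ⟨none, by simp, Or.inr ⟨hk, hzk⟩⟩
        · have hY : Y ≤ k := (Nat.le_ceil Y).trans (by
            exact_mod_cast (le_max_right _ _).trans (not_lt.1 hkK))
          obtain ⟨q, hq, hqD⟩ := hE (z k) k hzk hY (hz0 k hk)
          exact Set.mem_iUnion₂.2 ⟨some q, by simpa using hq, hk, not_lt.1 hkK, hzk, hqD⟩)
  cases o with
  | none =>
    refine ho (summable_indicator_union (S := {k | k < K}) (T := {k | k ∈ S ∧ z k = 0})
      (summable_indicator_finite (Set.finite_lt_nat K)) ?_)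
    refine summable_indicator_of_linear_bounded hM he (fun k hk => hN k hk.1) hlam (B := 1)
      fun k hk => ?_
    simpa [hk.2] using hNz k hk.1
  | some q =>
    have hk0 : ∀ k ∈ T (some q), (0 : ℝ) < k ∧ (1 : ℝ) ≤ k := fun k hk => by
      have : 1 ≤ k := (le_max_left _ _).trans hk.2.1
      have : (1 : ℝ) ≤ k := by exact_mod_cast this
      exact ⟨by linarith, this⟩
    have hann : ∀ k ∈ T (some q), z k / (k : ℝ) ^ q ∈ logAnnulus D := fun k hk =>
      div_rpow_mem_logAnnulus hk.2.2.1 (hk0 k hk).1 hk.2.2.2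
    obtain ⟨S', hS', hbig, C, hC, hlim⟩ :=
      exists_tendsto_on_nonsummable hM ho (isCompact_logAnnulus D) hann
    have hS'S : S' ⊆ S := fun k hk => (hS' hk).1
    have hne := neBot_atTop_inf_principal_of_nonsummable hbig
    have hmem : ∀ᶠ k in atTop ⊓ 𝓟 S', k ∈ S' := mem_inf_of_right (mem_principal_self _)
    rcases le_or_gt q 0 with hq | hq
    · refine hbig (summable_indicator_of_linear_bounded hM he (fun k hk => hN k (hS'S hk)) hlam
        (B := Real.exp D + 1) fun k hk => ?_)
      have h1 := (hann k (hS' hk)).2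
      have h2 : (0 : ℝ) < (k : ℝ) ^ q := Real.rpow_pos_of_pos (hk0 k (hS' hk)).1 q
      have h3 : (k : ℝ) ^ q ≤ 1 := Real.rpow_le_one_of_one_le_of_nonpos (hk0 k (hS' hk)).2 hq
      rw [abs_div, abs_of_pos h2, div_le_iff₀ h2] at h1
      have h4 : |z k| ≤ Real.exp D := h1.trans (mul_le_of_le_one_right (Real.exp_pos _).le h3)
      have h5 := abs_add_le ((N k : ℝ) - lam * k - z k) (z k)
      rw [sub_add_cancel] at h5
      linarith [hNz k (hS'S hk)]
    · have hq1 : q < 1 := by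
        -- Since z = o(k), the lower bound |z| ≥ exp (-D) * k ^ q is impossible for q ≥ 1.
        by_contra! hq1
        have hz : Tendsto (fun k => z k / (k : ℝ)) (atTop ⊓ 𝓟 S') (𝓝 0) := by
          have h1 := (h.mono_left
            (inf_le_inf_left atTop (principal_mono.2 hS'S))).sub_const lam
          rw [sub_self] at h1
          refine h1.congr' ?_
          filter_upwards [hmem] with k hk
          have := (hk0 k (hS' hk)).1
          simp only [z]
          field_simp
        have h1 : Real.exp (-D) ≤ 0 := by
          have h2 := hz.abs
          rw [abs_zero] at h2
          refine ge_of_tendsto h2 ?_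
          filter_upwards [hmem] with k hk
          have hk0' := (hk0 k (hS' hk)).1
          refine (hann k (hS' hk)).1.trans ?_
          rw [abs_div, abs_div, abs_of_pos hk0', abs_of_pos (Real.rpow_pos_of_pos hk0' q)]
          have h3 : (k : ℝ) ≤ (k : ℝ) ^ q := by
            simpa using Real.rpow_le_rpow_of_exponent_le (hk0 k (hS' hk)).2 hq1
          gcongr
        exact absurd h1 (not_le.2 (Real.exp_pos _))
      refine hbig (summable_indicator_of_linear_rpow hM he (fun k hk => hN k (hS'S hk)) hlam hq hq1
        (ne_zero_of_mem_logAnnulus hC) ?_)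
      have h1 := tendsto_div_rpow_of_bounded (l := atTop ⊓ 𝓟 S') (B := 1) hq inf_le_left
        (e := fun k : ℕ => (N k : ℝ) - lam * k - z k)
        (by filter_upwards [hmem] with k hk using hNz k (hS'S hk))
      have h2 := h1.add hlim
      rw [zero_add] at h2
      refine h2.congr fun k => ?_
      rw [← add_div, sub_add_cancel]

/-- Terms taken near the zeros of a polynomial are summable. -/
theorem summable_indicator_of_near_zeros (hM : ∀ k, 0 ≤ M k) (ha : CondA u) (hc : CondC u)
    (hd : CondD u) (he : CondE u)
    (hN : ∀ k ∈ S, M k ≤ ‖u (N k) k‖) {x : ℕ → ℝ} {H : MvPolynomial (Fin 2) ℝ} (hH : H ≠ 0)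
    (hx : ∀ k ∈ S, |(N k : ℝ) - x k| ≤ 1)
    (h0 : ∀ k ∈ S, MvPolynomial.eval ![x k, (k : ℝ)] H = 0) :
    Summable (S.indicator M) := by
  obtain ⟨E, D, Y, hE⟩ := exists_exponents_of_zeros H hH
  by_contra hS
  let K : ℕ := max 1 ⌈Y⌉₊
  -- Zeros x ≤ 0 force N ≤ 1, hence fall under the bounded case.
  let T : Option ℝ → Set ℕ := fun o => o.elim {k | k < K ∨ k ∈ S ∧ x k ≤ 0}
    fun q => {k | k ∈ S ∧ K ≤ k ∧ 0 < x k ∧ |Real.log |x k| - q * Real.log k| ≤ D}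
  obtain ⟨o, -, ho⟩ := exists_nonsummable_of_subset_biUnion hS (E := Finset.insertNone E) (T := T)
    (by
      intro k hk
      by_cases hkK : k < K
      · exact Set.mem_iUnion₂.2 ⟨none, by simp, Or.inl hkK⟩
      · rcases le_or_gt (x k) 0 with hxk | hxk
        · exact Set.mem_iUnion₂.2 ⟨none, by simp, Or.inr ⟨hk, hxk⟩⟩
        · have hY : Y ≤ k := (Nat.le_ceil Y).trans (by
            exact_mod_cast (le_max_right _ _).trans (not_lt.1 hkK))
          obtain ⟨q, hq, hqD⟩ := hE (x k) k hxk.ne' hY (h0 k hk)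
          exact Set.mem_iUnion₂.2 ⟨some q, by simpa using hq, hk, not_lt.1 hkK, hxk, hqD⟩)
  cases o with
  | none =>
    refine ho (summable_indicator_union (S := {k | k < K}) (T := {k | k ∈ S ∧ x k ≤ 0})
      (summable_indicator_finite (Set.finite_lt_nat K)) ?_)
    refine summable_indicator_of_bounded hM ha (fun k hk => hN k hk.1) (B := 1) fun k hk => ?_
    linarith [(abs_le.1 (hx k hk.1)).2, hk.2]
  | some p =>
    have hk0 : ∀ k ∈ T (some p), (0 : ℝ) < k ∧ (1 : ℝ) ≤ k := fun k hk => by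
      have : 1 ≤ k := (le_max_left _ _).trans hk.2.1
      have : (1 : ℝ) ≤ k := by exact_mod_cast this
      exact ⟨by linarith, this⟩
    have hann : ∀ k ∈ T (some p), x k / (k : ℝ) ^ p ∈ logAnnulus D := fun k hk =>
      div_rpow_mem_logAnnulus hk.2.2.1.ne' (hk0 k hk).1 hk.2.2.2
    obtain ⟨S', hS', hbig, C, hC, hlim⟩ :=
      exists_tendsto_on_nonsummable hM ho (isCompact_logAnnulus D) hann
    have hS'S : S' ⊆ S := fun k hk => (hS' hk).1
    have hne := neBot_atTop_inf_principal_of_nonsummable hbig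
    have hmem : ∀ᶠ k in atTop ⊓ 𝓟 S', k ∈ S' := mem_inf_of_right (mem_principal_self _)
    have hCpos : 0 < C := by
      refine lt_of_le_of_ne (ge_of_tendsto hlim ?_) (ne_zero_of_mem_logAnnulus hC).symm
      filter_upwards [hmem] with k hk
      exact div_nonneg (hS' hk).2.2.1.le (Real.rpow_nonneg (Nat.cast_nonneg _) _)
    rcases le_or_gt p 0 with hp | hp
    · refine hbig (summable_indicator_of_bounded hM ha (fun k hk => hN k (hS'S hk))
        (B := Real.exp D + 1) fun k hk => ?_)
      have h1 := (hann k (hS' hk)).2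
      have h2 : (0 : ℝ) < (k : ℝ) ^ p := Real.rpow_pos_of_pos (hk0 k (hS' hk)).1 p
      have h3 : (k : ℝ) ^ p ≤ 1 := Real.rpow_le_one_of_one_le_of_nonpos (hk0 k (hS' hk)).2 hp
      rw [abs_div, abs_of_pos h2, div_le_iff₀ h2] at h1
      have h4 : |x k| ≤ Real.exp D := h1.trans (mul_le_of_le_one_right (Real.exp_pos _).le h3)
      linarith [(abs_le.1 (hx k (hS'S hk))).2, le_abs_self (x k)]
    · by_cases hp1 : p = 1
      · subst hp1
        simp only [Real.rpow_one] at hlim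
        exact hbig (summable_indicator_of_near_linear hM he (fun k hk => hN k (hS'S hk)) hH
          (fun k hk => hx k (hS'S hk)) (fun k hk => h0 k (hS'S hk)) hCpos hlim)
      · refine hbig (summable_indicator_of_tendsto_div_rpow hM hc hd (fun k hk => hN k (hS'S hk))
          hp hp1 hCpos ?_)
        have h1 := tendsto_div_rpow_of_bounded (l := atTop ⊓ 𝓟 S') (B := 1) hp inf_le_left
          (e := fun k : ℕ => (N k : ℝ) - x k)
          (by filter_upwards [hmem] with k hk using hx k (hS'S hk))
        have h2 := h1.add hlim
        rw [zero_add] at h2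
        refine h2.congr fun k => ?_
        rw [← add_div, sub_add_cancel]

end Paths

/-! ### Restriction of polynomials to a column. -/

section Specialization

variable {R : Type*} [Field R]

/-- The univariate polynomial `p(X, y)`. -/
noncomputable def specializeSnd (y : R) (p : MvPolynomial (Fin 2) R) : Polynomial R :=
  MvPolynomial.aeval ![Polynomial.X, Polynomial.C y] p

theorem eval_specializeSnd (x y : R) (p : MvPolynomial (Fin 2) R) :
    (specializeSnd y p).eval x = MvPolynomial.eval ![x, y] p := by
  induction p using MvPolynomial.induction_on with
  | C z => simp [specializeSnd]
  | add p q hp hq =>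
    rw [map_add, ← hp, ← hq, ← Polynomial.eval_add]
    simp [specializeSnd]
  | mul_X p i hp =>
    rw [map_mul, ← hp, MvPolynomial.eval_X]
    fin_cases i <;> simp [specializeSnd]

theorem X_sub_C_dvd_sub_specialize (y : R) (p : MvPolynomial (Fin 2) R) :
    (MvPolynomial.X 1 - MvPolynomial.C y : MvPolynomial (Fin 2) R) ∣
      p - Polynomial.aeval (MvPolynomial.X 0) (specializeSnd y p) := by
  induction p using MvPolynomial.induction_on with
  | C z => simp [specializeSnd]
  | add p q hp hq =>
    have h : specializeSnd y (p + q) = specializeSnd y p + specializeSnd y q := map_add _ _ _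
    rw [h, map_add, add_sub_add_comm]
    exact dvd_add hp hq
  | mul_X p i hp =>
    have h : specializeSnd y (p * MvPolynomial.X i) =
        specializeSnd y p * ![Polynomial.X, Polynomial.C y] i := by simp [specializeSnd]
    rw [h, map_mul]
    fin_cases i
    · simp only [Fin.zero_eta, Matrix.cons_val_zero, Polynomial.aeval_X]
      rw [← sub_mul]
      exact hp.mul_right _
    · simp only [Fin.mk_one, Matrix.cons_val_one, Matrix.cons_val_zero, Polynomial.aeval_C,
        MvPolynomial.algebraMap_eq]
      have h2 : p * MvPolynomial.X 1 -
          Polynomial.aeval (MvPolynomial.X 0) (specializeSnd y p) * MvPolynomial.C y =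
          (p - Polynomial.aeval (MvPolynomial.X 0) (specializeSnd y p)) * MvPolynomial.X 1 +
          Polynomial.aeval (MvPolynomial.X 0) (specializeSnd y p) *
            (MvPolynomial.X 1 - MvPolynomial.C y) := by ring
      rw [h2]
      exact dvd_add (hp.mul_right _) (dvd_mul_left _ _)

/-- Otherwise Y - y would be a common factor, and it is not a unit since it vanishes at (0, y). -/
theorem specializeSnd_ne_zero_of_isRelPrime {f g : MvPolynomial (Fin 2) R} (h : IsRelPrime f g)
    (y : R) (hg : specializeSnd y g = 0) : specializeSnd y f ≠ 0 := by
  intro hf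
  have h1 := X_sub_C_dvd_sub_specialize y f
  have h2 := X_sub_C_dvd_sub_specialize y g
  rw [hf, map_zero, sub_zero] at h1
  rw [hg, map_zero, sub_zero] at h2
  have h3 := (h h1 h2).map (MvPolynomial.eval ![0, y])
  simp at h3

theorem eventually_eval_natCast_ne_zero [CharZero R] {q : Polynomial R} (hq : q ≠ 0) :
    ∀ᶠ n : ℕ in atTop, q.eval (n : R) ≠ 0 := by
  classical
  rw [← Nat.cofinite_eq_atTop, eventually_cofinite]
  refine ((q.roots.toFinset.finite_toSet).preimage (Nat.cast_injective.injOn)).subset fun n hn => ?_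
  simpa [hq] using hn

end Specialization

/-! ### Convergence of moduli in columns. -/

theorem eventually_nonneg_or_nonpos_eval (p : Polynomial ℝ) :
    (∀ᶠ x in atTop, 0 ≤ p.eval x) ∨ ∀ᶠ x in atTop, p.eval x ≤ 0 := by
  rcases le_or_gt p.degree 0 with hd | hd
  · rw [Polynomial.eq_C_of_degree_le_zero hd]
    rcases le_total 0 (p.coeff 0) with h | h
    · left; simp [h]
    · right; simp [h]
  · rcases le_total 0 p.leadingCoeff with h | h
    · exact Or.inl ((p.tendsto_atTop_of_leadingCoeff_nonneg hd h).eventually_ge_atTop 0)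
    · exact Or.inr ((p.tendsto_atBot_of_leadingCoeff_nonpos hd h).eventually_le_atBot 0)

theorem tendsto_of_eventually_monotone {v : ℕ → ℝ} {B : ℝ} (hB : ∀ n, |v n| ≤ B)
    (h : (∀ᶠ n in atTop, v n ≤ v (n + 1)) ∨ ∀ᶠ n in atTop, v (n + 1) ≤ v n) :
    ∃ l, Tendsto v atTop (𝓝 l) := by
  rcases h with h | h <;> obtain ⟨K, hK⟩ := eventually_atTop.1 h
  · have hm : Monotone fun n => v (n + K) := monotone_nat_of_le_succ fun n => by
      have := hK (n + K) (by omega)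
      rwa [add_right_comm] at this
    exact ⟨_, (tendsto_add_atTop_iff_nat K).1 (tendsto_atTop_ciSup hm
      ⟨B, by rintro _ ⟨n, rfl⟩; exact (abs_le.1 (hB _)).2⟩)⟩
  · have hm : Antitone fun n => v (n + K) := antitone_nat_of_succ_le fun n => by
      have := hK (n + K) (by omega)
      rwa [add_right_comm] at this
    exact ⟨_, (tendsto_add_atTop_iff_nat K).1 (tendsto_atTop_ciInf hm
      ⟨-B, by rintro _ ⟨n, rfl⟩; exact (abs_le.1 (hB _)).1⟩)⟩

/-- The moduli in a bounded column of a hypergeometric term converge. -/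
theorem exists_tendsto_norm_of_bounded {u : ℕ → ℕ → ℂ}
    (hu : QuotientIsRational (fun n k => u (n + 1) k) u) (k : ℕ) {B : ℝ}
    (hB : ∀ n, ‖u n k‖ ≤ B) : ∃ l, Tendsto (fun n => ‖u n k‖) atTop (𝓝 l) := by
  obtain ⟨f, g, -, hrel, hrec⟩ := hu
  -- If g vanishes on the whole column, the recurrence reads f u = 0 with f eventually nonzero, so u
  -- is eventually 0.
  by_cases hgk : specializeSnd (k : ℂ) g = 0
  · have hf := eventually_eval_natCast_ne_zero (specializeSnd_ne_zero_of_isRelPrime hrel _ hgk)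
    refine ⟨0, tendsto_const_nhds.congr' ?_⟩
    filter_upwards [hf] with n hn
    have h1 := hrec n k
    have h2 : evalNK g n k = 0 := by rw [evalNK, ← eval_specializeSnd, hgk, Polynomial.eval_zero]
    rw [eval_specializeSnd] at hn
    rw [h2, zero_mul, eq_comm, mul_eq_zero] at h1
    rw [h1.resolve_left hn, norm_zero]
  · have hg := eventually_eval_natCast_ne_zero hgk
    obtain ⟨F, hF, -⟩ := exists_normSq_polynomial f
    obtain ⟨G, hG, -⟩ := exists_normSq_polynomial g
    have hP : ∀ n : ℕ, (specializeSnd (k : ℝ) (F - G)).eval (n : ℝ) =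
        ‖evalNK f n k‖ ^ 2 - ‖evalNK g n k‖ ^ 2 := fun n => by
      rw [eval_specializeSnd, map_sub, hF, hG]
    have hrec' : ∀ n, ‖evalNK g n k‖ * ‖u (n + 1) k‖ = ‖evalNK f n k‖ * ‖u n k‖ := fun n => by
      rw [← norm_mul, ← norm_mul, hrec]
    refine tendsto_of_eventually_monotone (B := B) (fun n => by simpa using hB n) ?_
    refine (eventually_nonneg_or_nonpos_eval (specializeSnd (k : ℝ) (F - G))).imp
      (fun h => ?_) (fun h => ?_)
    · filter_upwards [hg, tendsto_natCast_atTop_atTop.eventually h] with n hn hs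
      rw [hP, sub_nonneg] at hs
      have h1 := (sq_le_sq₀ (norm_nonneg _) (norm_nonneg _)).1 hs
      rw [eval_specializeSnd] at hn
      refine le_of_mul_le_mul_left ?_ (norm_pos_iff.2 hn)
      exact (mul_le_mul_of_nonneg_right h1 (norm_nonneg _)).trans (hrec' n).ge
    · filter_upwards [hg, tendsto_natCast_atTop_atTop.eventually h] with n hn hs
      rw [hP, sub_nonpos] at hs
      have h1 := (sq_le_sq₀ (norm_nonneg _) (norm_nonneg _)).1 hs
      rw [eval_specializeSnd] at hn
      refine le_of_mul_le_mul_left ?_ (norm_pos_iff.2 hn)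
      exact (hrec' n).le.trans (mul_le_mul_of_nonneg_right h1 (norm_nonneg _))

/-! ### Location of column maxima. -/

/-- A convergent sequence is bounded by its limit, or it has a first maximum. -/
theorem le_limit_or_exists_first_max {v : ℕ → ℝ} {l : ℝ} (h : Tendsto v atTop (𝓝 l)) :
    (∀ n, v n ≤ l) ∨ ∃ N, (∀ n, v n ≤ v N) ∧ ∀ n < N, v n < v N := by
  classical
  by_cases hle : ∀ n, v n ≤ l
  · exact Or.inl hle
  right
  push Not at hle
  obtain ⟨n₀, hn₀⟩ := hle
  obtain ⟨K, hK⟩ := eventually_atTop.1 (h.eventually_lt_const hn₀)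
  obtain ⟨m, -, hm⟩ := (Finset.range (K + n₀ + 1)).exists_max_image v ⟨0, by simp⟩
  have hex : ∃ N, ∀ n, v n ≤ v N := ⟨m, fun n => by
    rcases lt_or_ge n K with hn | hn
    · exact hm n (Finset.mem_range.2 (by omega))
    · exact (hK n hn).le.trans (hm n₀ (Finset.mem_range.2 (by omega)))⟩
  refine ⟨Nat.find hex, Nat.find_spec hex, fun n hn => ?_⟩
  have h1 := Nat.find_min hex hn
  push Not at h1
  obtain ⟨m', hm'⟩ := h1
  exact hm'.trans_le (Nat.find_spec hex m')

/-- The first maximum in a column of a hypergeometric term is near a zero of a polynomial. -/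
theorem exists_polynomial_vanishing_near_max {u : ℕ → ℕ → ℂ}
    (hu : QuotientIsRational (fun n k => u (n + 1) k) u) :
    ∃ H : MvPolynomial (Fin 2) ℝ, H ≠ 0 ∧ ∀ N k : ℕ, (∀ n, ‖u n k‖ ≤ ‖u N k‖) → N ≠ 0 →
      (∀ n < N, ‖u n k‖ < ‖u N k‖) →
      ∃ x : ℝ, |(N : ℝ) - x| ≤ 1 ∧ MvPolynomial.eval ![x, (k : ℝ)] H = 0 := by
  classical
  obtain ⟨f, g, hg0, -, hrec⟩ := hu
  obtain ⟨F, hF, -⟩ := exists_normSq_polynomial f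
  obtain ⟨G, hG, hG0⟩ := exists_normSq_polynomial g
  have hrec' : ∀ n k, ‖evalNK g n k‖ * ‖u (n + 1) k‖ = ‖evalNK f n k‖ * ‖u n k‖ := fun n k => by
    rw [← norm_mul, ← norm_mul, hrec]
  -- The factor G covers the points where the recurrence degenerates. If F = G, moduli cannot rise
  -- where g ≠ 0, so G alone suffices.
  refine ⟨if F - G = 0 then G else (F - G) * G, ?_, fun N k hmax hN hlt => ?_⟩
  · split_ifs with h
    · exact hG0 hg0
    · exact mul_ne_zero h (hG0 hg0)
  obtain ⟨m, rfl⟩ := Nat.exists_eq_succ_of_ne_zero hN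
  have hltm := hlt m (Nat.lt_succ_self m)
  have hzero : ∀ x : ℝ, MvPolynomial.eval ![x, (k : ℝ)] G = 0 →
      MvPolynomial.eval ![x, (k : ℝ)] (if F - G = 0 then G else (F - G) * G) = 0 := fun x hx => by
    split_ifs <;> simp [hx]
  by_cases hgm : evalNK g m k = 0
  · exact ⟨m, by simp, hzero _ (by rw [hG, hgm]; simp)⟩
  by_cases hgN : evalNK g (m + 1) k = 0
  · exact ⟨(m + 1 : ℕ), by simp, hzero _ (by rw [hG, hgN]; simp)⟩
  have hpos : 0 < ‖u (m + 1) k‖ := (norm_nonneg _).trans_lt hltm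
  have h1 : ‖evalNK g m k‖ < ‖evalNK f m k‖ := by
    by_contra! hcon
    have h2 := mul_lt_mul_of_pos_left hltm (norm_pos_iff.2 hgm)
    have h3 := mul_le_mul_of_nonneg_right hcon (norm_nonneg (u m k))
    linarith [hrec' m k]
  have h2 : ‖evalNK f (m + 1) k‖ ≤ ‖evalNK g (m + 1) k‖ := by
    refine le_of_mul_le_mul_right ?_ hpos
    rw [← hrec']
    exact mul_le_mul_of_nonneg_left (hmax _) (norm_nonneg _)
  let φ : ℝ → ℝ := fun x => MvPolynomial.eval ![x, (k : ℝ)] (F - G)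
  have hφ : ∀ n : ℕ, φ n = ‖evalNK f n k‖ ^ 2 - ‖evalNK g n k‖ ^ 2 := fun n => by
    simp only [φ, map_sub, hF, hG]
  have hcont : Continuous φ := (MvPolynomial.continuous_eval (F - G)).comp
    (continuous_pi fun i => by fin_cases i <;> simp <;> fun_prop)
  have h3 : 0 < φ m := by
    rw [hφ, sub_pos]; exact (sq_lt_sq₀ (norm_nonneg _) (norm_nonneg _)).2 h1
  have h4 : φ (m + 1 : ℕ) ≤ 0 := by
    rw [hφ, sub_nonpos]; exact (sq_le_sq₀ (norm_nonneg _) (norm_nonneg _)).2 h2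
  -- The strict rise into N = m + 1 and the absence of a rise out of it give φ opposite signs at m
  -- and m + 1.
  obtain ⟨x, hx, hx0⟩ := intermediate_value_Icc' (f := φ) (a := (m : ℝ)) (b := (m + 1 : ℕ))
    (by simp) hcont.continuousOn ⟨h4, h3.le⟩
  refine ⟨x, ?_, ?_⟩
  · obtain ⟨hx1, hx2⟩ := hx
    push_cast at hx2 ⊢
    rw [abs_le]; constructor <;> linarith
  · rw [if_neg fun h => by simp [φ, h] at h3]
    simp only [φ] at hx0
    rw [map_mul, hx0, zero_mul]

/-! ### The equivalences. -/

theorem uniformlyDominatedConvergent_of_conditions {u : ℕ → ℕ → ℂ}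
    (hu : QuotientIsRational (fun n k => u (n + 1) k) u) (ha : CondA u) (hb : CondBAbs u)
    (hc : CondC u) (hd : CondD u) (he : CondE u) :
    UniformlyDominatedConvergent (fun k n => u n k) := by
  obtain ⟨L, hL, hLs⟩ := hb
  obtain ⟨H, hH, hHz⟩ := exists_polynomial_vanishing_near_max hu
  have hL0 : ∀ k, 0 ≤ L k := fun k => ge_of_tendsto' (hL k) fun n => norm_nonneg _
  have hex : ∀ k, ∃ (M : ℝ) (N : ℕ), (∀ n, ‖u n k‖ ≤ M) ∧ (M = L k ∨
      (M = ‖u N k‖ ∧ ∀ n < N, ‖u n k‖ < ‖u N k‖)) := fun k => by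
    rcases le_limit_or_exists_first_max (hL k) with h | ⟨N, h1, h2⟩
    · exact ⟨L k, 0, h, Or.inl rfl⟩
    · exact ⟨_, N, h1, Or.inr ⟨rfl, h2⟩⟩
  choose M N hMN hcase using hex
  have hM : ∀ k, 0 ≤ M k := fun k => (norm_nonneg _).trans (hMN k 0)
  refine ⟨M, fun n k => hMN k n, ?_⟩
  -- A maximum at N = 0 has no preceding row to compare with; it is handled by (a) for row 0.
  let S : Set ℕ := {k | N k ≠ 0 ∧ M k = ‖u (N k) k‖ ∧ ∀ n < N k, ‖u n k‖ < ‖u (N k) k‖}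
  have hroot : ∀ k, ∃ x : ℝ, k ∈ S →
      |(N k : ℝ) - x| ≤ 1 ∧ MvPolynomial.eval ![x, (k : ℝ)] H = 0 := fun k => by
    by_cases hk : k ∈ S
    · obtain ⟨x, hx⟩ := hHz (N k) k (fun n => (hMN k n).trans hk.2.1.le) hk.1 hk.2.2
      exact ⟨x, fun _ => hx⟩
    · exact ⟨0, fun h => absurd h hk⟩
  choose x hx using hroot
  have h1 : Summable ({k | M k = L k}.indicator M) :=
    summable_indicator_of_le hM hLs hL0 fun k hk => le_of_eq hk
  have h2 : Summable ({k | M k = ‖u 0 k‖}.indicator M) :=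
    summable_indicator_of_le hM (ha 0) (fun _ => norm_nonneg _) fun k hk => le_of_eq hk
  have h3 : Summable (S.indicator M) :=
    summable_indicator_of_near_zeros hM ha hc hd he (fun k hk => hk.2.1.le) hH
      (fun k hk => (hx k hk).1) fun k hk => (hx k hk).2
  have h4 := summable_indicator_union (summable_indicator_union h1 h2) h3
  have huniv : {k | M k = L k} ∪ {k | M k = ‖u 0 k‖} ∪ S = Set.univ := by
    refine Set.eq_univ_of_forall fun k => ?_
    rcases hcase k with h | ⟨h, h'⟩
    · exact Or.inl (Or.inl h)
    · by_cases hN : N k = 0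
      · rw [hN] at h
        exact Or.inl (Or.inr h)
      · exact Or.inr ⟨hN, h, h'⟩
  rwa [huniv, Set.indicator_univ] at h4

theorem UniformlyDominatedConvergent.convergesAbsolutely {u : ℕ → ℕ → ℂ}
    (h : UniformlyDominatedConvergent (fun k n => u n k)) (N : ℕ → ℕ) :
    ConvergesAbsolutely fun k => u (N k) k := by
  obtain ⟨M, hM, hMs⟩ := h
  exact Summable.of_nonneg_of_le (fun _ => norm_nonneg _) (fun k => hM (N k) k) hMs

theorem UniformlyDominatedConvergent.condBAbs {u : ℕ → ℕ → ℂ}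
    (h : UniformlyDominatedConvergent (fun k n => u n k))
    (hu : QuotientIsRational (fun n k => u (n + 1) k) u) : CondBAbs u := by
  obtain ⟨M, hM, hMs⟩ := h
  choose L hL using fun k => exists_tendsto_norm_of_bounded hu k (fun n => hM n k)
  exact ⟨L, hL, Summable.of_nonneg_of_le
    (fun k => ge_of_tendsto' (hL k) fun n => norm_nonneg _)
    (fun k => le_of_tendsto' (hL k) fun n => hM n k) hMs⟩

theorem condB_iff_condBAbs {u : ℕ → ℕ → ℂ}
    (h : ∀ k, ∃ l : ℂ, Tendsto (fun n => u n k) atTop (𝓝 l)) : CondB u ↔ CondBAbs u := by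
  constructor
  · rintro ⟨L, hL, hs⟩
    exact ⟨fun k => ‖L k‖, fun k => (hL k).norm, hs⟩
  · rintro ⟨L, hL, hs⟩
    choose l hl using h
    exact ⟨l, hl, hs.congr fun k => tendsto_nhds_unique (hL k) (hl k).norm⟩

theorem lemma2 (u : ℕ → ℕ → ℂ) (hu : IsHypergeometricTerm u)
    (hnt : ∀ᶠ n in atTop, IsNonterminating (u n)) :
    (UniformlyDominatedConvergent (fun k n => u n k) ↔
      CondA u ∧ CondBAbs u ∧ CondC u ∧ CondD u ∧ CondE u) ∧
    ((∀ k, ∃ l : ℂ, Tendsto (fun n => u n k) atTop (𝓝 l)) →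
      (UniformlyDominatedConvergent (fun k n => u n k) ↔
        CondA u ∧ CondB u ∧ CondC u ∧ CondD u ∧ CondE u)) := by
  have key : UniformlyDominatedConvergent (fun k n => u n k) ↔
      CondA u ∧ CondBAbs u ∧ CondC u ∧ CondD u ∧ CondE u :=
    ⟨fun h => ⟨fun n => h.convergesAbsolutely fun _ => n, h.condBAbs hu.1,
      fun N _ _ _ => h.convergesAbsolutely N, fun N _ _ _ _ => h.convergesAbsolutely N,
      fun N _ => h.convergesAbsolutely N⟩,
    fun ⟨ha, hb, hc, hd, he⟩ => uniformlyDominatedConvergent_of_conditions hu.1 ha hb hc hd he⟩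
  exact ⟨key, fun hlim => by rw [condB_iff_condBAbs hlim]; exact key⟩
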